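/- Let $\mathbb K$ be $\mathbb R$ or $\mathbb C$, let $m\ge 1$ and $\mathbf p=(p_1,\dots,p_m)\in[1,\infty]^m$, write $\left|\frac1{\mathbf p}\right|:=\frac1{p_1}+\cdots+\frac1{p_m}$ (with $1/\infty=0$), and assume $0\le\left|\frac1{\mathbf p}\right|<1$. For $k\ge1$ and integers $n_1,\dots,n_k\ge1$ with $n_1+\cdots+n_k=m$ (so $k\le m$), let $(e_{i_1}^{n_1},\dots,e_{i_k}^{n_k})$ denote $(e_{i_1},\dots,e_{i_1},\dots,e_{i_k},\dots,e_{i_k})$, where $e_{i_r}$ is repeated $n_r$ times, and for $\rho>0$, $C\geq 0$ consider the inequality $$\Big(\sum_{i_1,\dots,i_k=1}^N\big|T(e_{i_1}^{n_1},\dots,e_{i_k}^{n_k})\big|^{\rho}\Big)^{1/\rho}\le C\,\|T\|\quad\text{for all } N\ge1\text{ and all continuous $m$-linear } T:\ell_{p_1}^N\times\cdots\times\ell_{p_m}^N\to\mathbb K.\qquad(*)$$ (1) Suppose $\frac12\le\left|\frac1{\mathbf p}\right|<1$ and put $\rho=\frac1{1-|1/\mathbf p|}$. There is a least constant $D=D_{m,\mathbf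 p}^{\mathbb K}$ for which the full-sum inequality $\big(\sum_{i_1,\dots,i_m=1}^N|T(e_{i_1},\dots,e_{i_m})|^{\rho}\big)^{1/\rho}\le D\|T\|$ holds for all $N\geq 1$ and all such $T$; one has $D_{m,\mathbf p}^{\mathbb K}\ge1$; and, for all $k$ and $n_1,\dots,n_k$ as above, $(*)$ holds with this $\rho$ and $C=D_{m,\mathbf p}^{\mathbb K}$. Moreover, for all $k$ and $n_1,\dots,n_k$ the exponent $\rho$ is optimal: it is the least positive exponent for which $(*)$ holds with some finite constant. (2) Suppose $0\le\left|\frac1{\mathbf p}\right|<\frac12$. There is a constant $C\ge1$, depending only on $m$, $\mathbf p$ and $\mathbb K$, such that for all $k$ and $n_1,\dots,n_k$ as above $(*)$ holds with $\rho=\frac{2k}{k+1-2|1/\mathbf p|}$ and this constant $C$. In particular, for each choice of $k$ and $n_1,\dots,n_k$ there is a least constant (the optimal constant, written $C_{k,m,\mathbf p}^{\mathbb K}$) for which $(*)$ holds with this $\rho$, and $1\le C_{k,m,\mathbf p}^{\mathbb K}\le C$. -/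

import Mathlib

open scoped ENNReal

/-- `|1/p| = 1/p₁ + ⋯ + 1/pₘ`, with `1/∞ = 0`. -/
noncomputable def invSum {m : ℕ} (p : Fin m → ℝ≥0∞) : ℝ :=
  ∑ j, ((p j)⁻¹).toReal

/-- The `i`-th canonical vector of `ℓ_p^N` over `𝕜`. -/
noncomputable def canonVec (𝕜 : Type*) [RCLike 𝕜] (p : ℝ≥0∞) {N : ℕ} (i : Fin N) :
    PiLp p (fun _ : Fin N => 𝕜) :=
  WithLp.toLp p (Pi.single i (1 : 𝕜))

/-- The `ℓ_ρ`-sum of the coefficients of `T` over one index `i a ∈ {1, …, N}` for each block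
`a : κ`, where the `j`-th argument of `T` is the canonical vector numbered by the index of the
block `b j` of the position `j`.
For `b = id` this is the full sum over `i₁, …, iₘ`. For `b = c.index`, where `c` is the
composition `m = n₁ + ⋯ + nₖ` (with `k = c.length` and all `nᵢ ≥ 1`), the vector of arguments is
`(e_{i₁}, …, e_{i₁}, …, e_{iₖ}, …, e_{iₖ})`, with `e_{iᵣ}` repeated `nᵣ` times. -/
noncomputable def blockSum {𝕜 : Type*} [RCLike 𝕜] {m : ℕ} {p : Fin m → ℝ≥0∞}
    [∀ j, Fact (1 ≤ p j)] {N : ℕ} {κ : Type} [Fintype κ] [DecidableEq κ] (b : Fin m → κ)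
    (T : ContinuousMultilinearMap 𝕜 (fun j : Fin m => PiLp (p j) (fun _ : Fin N => 𝕜)) 𝕜)
    (ρ : ℝ) : ℝ :=
  (∑ i : κ → Fin N, ‖T (fun j => canonVec 𝕜 (p j) (i (b j)))‖ ^ ρ) ^ (1 / ρ)

/-- The inequality `blockSum ≤ C ‖T‖` with exponent `ρ`, for all positive integers `N` and all
continuous `m`-linear forms `T` on `ℓ_{p₁}^N × ⋯ × ℓ_{pₘ}^N`. -/
def BlockIneq (𝕜 : Type*) [RCLike 𝕜] {m : ℕ} (p : Fin m → ℝ≥0∞) [∀ j, Fact (1 ≤ p j)]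
    {κ : Type} [Fintype κ] [DecidableEq κ] (b : Fin m → κ) (ρ C : ℝ) : Prop :=
  ∀ N : ℕ, 0 < N →
    ∀ T : ContinuousMultilinearMap 𝕜 (fun j : Fin m => PiLp (p j) (fun _ : Fin N => 𝕜)) 𝕜,
      blockSum b T ρ ≤ C * ‖T‖

/-- `C` is the optimal (that is, the least) constant in the inequality with exponent `ρ`. -/
def IsOptimalConst (𝕜 : Type*) [RCLike 𝕜] {m : ℕ} (p : Fin m → ℝ≥0∞) [∀ j, Fact (1 ≤ p j)]
    {κ : Type} [Fintype κ] [DecidableEq κ] (b : Fin m → κ) (ρ C : ℝ) : Prop :=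
  IsLeast {C' : ℝ | BlockIneq 𝕜 p b ρ C'} C

/-- `ρ` is the optimal (that is, the least positive) exponent for which the inequality holds
with some finite constant. -/
def IsOptimalExponent (𝕜 : Type*) [RCLike 𝕜] {m : ℕ} (p : Fin m → ℝ≥0∞) [∀ j, Fact (1 ≤ p j)]
    {κ : Type} [Fintype κ] [DecidableEq κ] (b : Fin m → κ) (ρ : ℝ) : Prop :=
  IsLeast {σ : ℝ | 0 < σ ∧ ∃ C : ℝ, BlockIneq 𝕜 p b σ C} ρ

section HardyLittlewood

open Finset
open scoped BigOperators

/-! Write A = |1/p| and αⱼ = 1/pⱼ. A form is replaced by its coefficient array, and its norm enters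
only through the bound on arguments u ^ αⱼ · z (`FormBound`). Random signs and the Khinchine
inequality give a weighted mixed (ℓ₁, ℓ₂) estimate, `FormBound.sum_sqrt_le`. For A ≤ 1/2, taking
weights built from the slice norms Sⱼ themselves bootstraps it to ∑ₓ Sⱼ(x) ^ (1/(1 - A)) ≤ 1 for
normalised forms (`sum_sliceNorm_rpow_le_one`), and interpolating between the k slicing directions
yields the exponent 2k/(k + 1 - 2A). At A = 1/2 this exponent is 2 for every k. For A ≥ 1/2, part of
the weights is frozen so that the remaining exponents sum to 1/2; the weighted ℓ₂ bound, valid for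
all frozen weights, becomes an ℓ_{1/(1 - A)} bound by duality.

For A ≥ 1/2 the exponent does not depend on the number of indices, so a block sum is merely a part
of the full sum. For A < 1/2 the exponent grows with the number of indices and this is not enough;
instead `FormBound.comp_block` shows, by averaging over signs, that the restriction to block
diagonals is a k-linear form with the same bound and the same A.

The lower bounds on constants and exponents come from `diagForm`, which has norm at most N ^ (1 - A)
and contributes N coefficients equal to 1 to every block sum. -/

theorem expect_units_int (g : ℤˣ → ℝ) : 𝔼 s, g s = (g 1 + g (-1)) / 2 := by
  rw [Fintype.expect_eq_sum_div_card, UnitsInt.univ, Finset.sum_pair (by decide)]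
  simp

theorem expect_fin_cons_signs {N : ℕ} (f : (Fin (N + 1) → ℤˣ) → ℝ) :
    𝔼 ε, f ε = 𝔼 ε : Fin N → ℤˣ, (f (Fin.cons 1 ε) + f (Fin.cons (-1) ε)) / 2 := by
  rw [← Fintype.expect_equiv (Fin.consEquiv fun _ : Fin (N + 1) => ℤˣ)
    (fun x => f (Fin.cons x.1 x.2)) f (fun _ => rfl)]
  rw [← Finset.univ_product_univ, Finset.expect_product, Finset.expect_comm]
  refine Finset.expect_congr rfl fun ε _ => ?_
  rw [expect_units_int]

/-! ### Moments of sign sums and Khinchine inequalities -/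

section Moments
variable {𝕜 H : Type*} [RCLike 𝕜] [NormedAddCommGroup H] [InnerProductSpace 𝕜 H]

/-- The sum of the vectors `v i` with signs `ε i`. -/
def signSum {N : ℕ} (v : Fin N → H) (ε : Fin N → ℤˣ) : H := ∑ i, (ε i : ℤ) • v i

theorem signSum_cons_one {N : ℕ} (v : Fin (N + 1) → H) (ε : Fin N → ℤˣ) :
    signSum v (Fin.cons 1 ε) = signSum (fun i => v i.succ) ε + v 0 := by
  simp [signSum, Fin.sum_univ_succ, add_comm]

theorem signSum_cons_neg_one {N : ℕ} (v : Fin (N + 1) → H) (ε : Fin N → ℤˣ) :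
    signSum v (Fin.cons (-1) ε) = signSum (fun i => v i.succ) ε - v 0 := by
  simp [signSum, Fin.sum_univ_succ, sub_eq_add_neg, add_comm]

include 𝕜 in
theorem expect_norm_signSum_sq {N : ℕ} (v : Fin N → H) :
    𝔼 ε, ‖signSum v ε‖ ^ 2 = ∑ i, ‖v i‖ ^ 2 := by
  induction N with
  | zero => simp [signSum]
  | succ N ih =>
    rw [expect_fin_cons_signs, Fin.sum_univ_succ, ← ih (fun i => v i.succ),
      ← Finset.expect_const (univ_nonempty (α := Fin N → ℤˣ)) (‖v 0‖ ^ 2),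
      ← Finset.expect_add_distrib]
    refine Finset.expect_congr rfl fun ε _ => ?_
    rw [signSum_cons_one, signSum_cons_neg_one]
    have := parallelogram_law_with_norm 𝕜 (signSum (fun i => v i.succ) ε) (v 0)
    nlinarith

-- The parallelogram law fixes the sum of the two squared norms, and the triangle inequality bounds
-- their difference by 4‖x‖‖v‖.
include 𝕜 in
theorem norm_add_pow_four_add_norm_sub_pow_four_le (x v : H) :
    ‖x + v‖ ^ 4 + ‖x - v‖ ^ 4 ≤ 2 * ‖x‖ ^ 4 + 12 * (‖x‖ ^ 2 * ‖v‖ ^ 2) + 2 * ‖v‖ ^ 4 := by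
  have h := parallelogram_law_with_norm 𝕜 x v
  have h1 := norm_add_le x v
  have h2 := norm_sub_le x v
  set a := ‖x + v‖ ^ 2 with ha
  set b := ‖x - v‖ ^ 2 with hb
  have hab : a + b = 2 * (‖x‖ ^ 2 + ‖v‖ ^ 2) := by nlinarith
  have h1' : a ≤ (‖x‖ + ‖v‖) ^ 2 := by rw [ha]; gcongr
  have h2' : b ≤ (‖x‖ + ‖v‖) ^ 2 := by rw [hb]; gcongr
  have h3 : (a - b) ^ 2 ≤ (4 * (‖x‖ * ‖v‖)) ^ 2 := by
    apply sq_le_sq'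
    · nlinarith
    · nlinarith
  have e1 : ‖x + v‖ ^ 4 = a ^ 2 := by rw [ha]; ring
  have e2 : ‖x - v‖ ^ 4 = b ^ 2 := by rw [hb]; ring
  rw [e1, e2]
  have : a ^ 2 + b ^ 2 = ((a + b) ^ 2 + (a - b) ^ 2) / 2 := by ring
  rw [this, hab]
  nlinarith

include 𝕜 in
theorem expect_norm_signSum_pow_four_le {N : ℕ} (v : Fin N → H) :
    𝔼 ε, ‖signSum v ε‖ ^ 4 ≤ 3 * (∑ i, ‖v i‖ ^ 2) ^ 2 := by
  induction N with
  | zero => simp [signSum]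
  | succ N ih =>
    rw [expect_fin_cons_signs, Fin.sum_univ_succ]
    have key : ∀ ε : Fin N → ℤˣ,
        (‖signSum v (Fin.cons 1 ε)‖ ^ 4 + ‖signSum v (Fin.cons (-1) ε)‖ ^ 4) / 2 ≤
          ‖signSum (fun i => v i.succ) ε‖ ^ 4 +
            6 * ‖v 0‖ ^ 2 * ‖signSum (fun i => v i.succ) ε‖ ^ 2 + ‖v 0‖ ^ 4 := by
      intro ε
      rw [signSum_cons_one, signSum_cons_neg_one]
      have := norm_add_pow_four_add_norm_sub_pow_four_le (𝕜 := 𝕜)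
        (signSum (fun i => v i.succ) ε) (v 0)
      linarith
    refine (Finset.expect_le_expect fun ε _ => key ε).trans ?_
    rw [Finset.expect_add_distrib, Finset.expect_add_distrib, Finset.expect_const univ_nonempty,
      ← Finset.mul_expect, expect_norm_signSum_sq (𝕜 := 𝕜)]
    have := ih (fun i => v i.succ)
    have h4 : ‖v 0‖ ^ 4 = (‖v 0‖ ^ 2) ^ 2 := by ring
    nlinarith [sq_nonneg (‖v 0‖ ^ 2)]

include 𝕜 in
/-- The Khinchine inequality between `L¹` and `L²` in an inner product space. -/
theorem sqrt_sum_norm_sq_le_expect_norm_signSum {N : ℕ} (v : Fin N → H) :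
    √(∑ i, ‖v i‖ ^ 2) ≤ 16 / 9 * 𝔼 ε, ‖signSum v ε‖ := by
  set σ := √(∑ i, ‖v i‖ ^ 2) with hσ
  have hσ0 : 0 ≤ σ := Real.sqrt_nonneg _
  have hσ2 : σ ^ 2 = ∑ i, ‖v i‖ ^ 2 := Real.sq_sqrt (sum_nonneg fun _ _ => by positivity)
  rcases hσ0.eq_or_lt with h | h
  · rw [← h]
    exact mul_nonneg (by norm_num) (Finset.expect_nonneg fun _ _ => norm_nonneg _)
  -- The difference of the two sides is y (y - 2σ)² (y + 4σ). Averaging, with second moment σ² and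
  -- fourth moment at most 3σ⁴, leaves 9σ⁴ ≤ 16σ³ 𝔼‖signSum‖, whence 16/9.
  have key : ∀ y : ℝ, 0 ≤ y → 12 * σ ^ 2 * y ^ 2 - y ^ 4 ≤ 16 * σ ^ 3 * y := by
    intro y hy
    have : 0 ≤ y * ((y - 2 * σ) ^ 2 * (y + 4 * σ)) := by positivity
    nlinarith
  have h1 : 𝔼 ε, (12 * σ ^ 2 * ‖signSum v ε‖ ^ 2 - ‖signSum v ε‖ ^ 4) ≤
      𝔼 ε, 16 * σ ^ 3 * ‖signSum v ε‖ :=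
    Finset.expect_le_expect fun ε _ => key _ (norm_nonneg _)
  rw [Finset.expect_sub_distrib, ← Finset.mul_expect, ← Finset.mul_expect,
    expect_norm_signSum_sq (𝕜 := 𝕜), ← hσ2] at h1
  have h2 := expect_norm_signSum_pow_four_le (𝕜 := 𝕜) v
  rw [← hσ2] at h2
  have h3 : σ ^ 3 * (9 * σ) ≤ σ ^ 3 * (16 * 𝔼 ε, ‖signSum v ε‖) := by nlinarith
  have := le_of_mul_le_mul_left h3 (by positivity)
  linarith

end Moments

/-- The Khinchine inequality for decoupled Rademacher chaoses. -/
theorem sqrt_sum_norm_sq_le_expect_norm_chaos {𝕜 : Type*} [RCLike 𝕜] {N k : ℕ}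
    (b : (Fin k → Fin N) → 𝕜) :
    √(∑ i, ‖b i‖ ^ 2) ≤
      (16 / 9) ^ k * 𝔼 ε : Fin k → Fin N → ℤˣ, ‖∑ i, b i * ∏ j, ((ε j (i j) : ℤ) : 𝕜)‖ := by
  induction k with
  | zero => simp
  | succ k ih =>
    -- The slices in the first index are vectors of a Hilbert space: the vector-valued inequality
    -- handles the first family of signs, and the induction hypothesis handles the norm of each
    -- signed sum of slices.
    let v : Fin N → EuclideanSpace 𝕜 (Fin k → Fin N) := fun x =>
      WithLp.toLp 2 fun i => b (Fin.cons x i)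
    have hsum : ∑ i, ‖b i‖ ^ 2 = ∑ x, ‖v x‖ ^ 2 := by
      rw [← (Fin.consEquiv fun _ : Fin (k + 1) => Fin N).sum_comp, Fintype.sum_prod_type]
      refine sum_congr rfl fun x _ => ?_
      rw [EuclideanSpace.norm_sq_eq]
      rfl
    have hv : ∀ ε : Fin N → ℤˣ, ‖signSum v ε‖ ≤ (16 / 9) ^ k *
        𝔼 η : Fin k → Fin N → ℤˣ,
          ‖∑ i, b i * ∏ j, (((Fin.cons ε η : Fin (k + 1) → Fin N → ℤˣ) j (i j) : ℤ) : 𝕜)‖ := by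
      intro ε
      have := ih fun i => signSum v ε i
      rw [← EuclideanSpace.norm_eq] at this
      refine this.trans (le_of_eq ?_)
      congr 1
      refine Finset.expect_congr rfl fun η _ => ?_
      rw [← (Fin.consEquiv fun _ : Fin (k + 1) => Fin N).sum_comp, Fintype.sum_prod_type,
        sum_comm]
      congr 1
      refine sum_congr rfl fun i _ => ?_
      simp [signSum, Fin.prod_univ_succ, Fin.consEquiv, v, Finset.sum_mul]
      refine sum_congr rfl fun x _ => ?_
      ring
    rw [hsum]
    refine (sqrt_sum_norm_sq_le_expect_norm_signSum (𝕜 := 𝕜) v).trans ?_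
    rw [← Fintype.expect_equiv (Fin.consEquiv fun _ : Fin (k + 1) => Fin N → ℤˣ)
      (fun x => ‖∑ i, b i * ∏ j, (((Fin.cons x.1 x.2 : Fin (k + 1) → Fin N → ℤˣ) j (i j) : ℤ) : 𝕜)‖)
      _ (fun _ => rfl)]
    rw [← Finset.univ_product_univ, Finset.expect_product, pow_succ', mul_assoc]
    refine mul_le_mul_of_nonneg_left ?_ (by norm_num : (0 : ℝ) ≤ 16 / 9)
    rw [Finset.mul_expect]
    exact Finset.expect_le_expect fun ε _ => hv ε

/-! ### Coefficient arrays and the mixed-norm estimate -/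

section Arrays
variable {𝕜 : Type*} [RCLike 𝕜]

/-- The `k`-linear form with coefficients `a` is bounded by `M` on the product of the unit balls
of `ℓ_{1/αⱼ}`: a vector of this ball is a product of `u ^ αⱼ`, where `u ≥ 0` has sum at most `1`,
and of a vector with entries in the unit disc. -/
def FormBound {k N : ℕ} (a : (Fin k → Fin N) → 𝕜) (α : Fin k → ℝ) (M : ℝ) : Prop :=
  ∀ (u : Fin k → Fin N → ℝ) (z : Fin k → Fin N → 𝕜), (∀ j x, 0 ≤ u j x) → (∀ j, ∑ x, u j x ≤ 1) →
    (∀ j x, ‖z j x‖ ≤ 1) →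
    ‖∑ i, a i * ∏ j, (((u j (i j) ^ α j : ℝ) : 𝕜) * z j (i j))‖ ≤ M

theorem sum_filter_apply_eq_sum_insertNth {R : Type*} [AddCommMonoid R] {n N : ℕ} (l : Fin (n + 1))
    (x : Fin N) (F : (Fin (n + 1) → Fin N) → R) :
    ∑ i with i l = x, F i = ∑ i' : Fin n → Fin N, F (l.insertNth x i') := by
  rw [sum_filter, ← (Fin.insertNthEquiv (fun _ => Fin N) l).sum_comp, Fintype.sum_prod_type]
  simp [Fin.insertNthEquiv]

/-- Each slice norm is at most a constant times the mean of a chaos in the other n indices. Once the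
sum over x is inside the mean, for fixed signs the sum of absolute values is itself a value of the
form: the signs enter the other arguments and unimodular factors aligning the phases enter the
`l`-th. -/
theorem FormBound.sum_sqrt_le {n N : ℕ} {a : (Fin (n + 1) → Fin N) → 𝕜} {α : Fin (n + 1) → ℝ}
    {M : ℝ} (h : FormBound a α M) {u : Fin (n + 1) → Fin N → ℝ} (hu0 : ∀ j x, 0 ≤ u j x)
    (hu1 : ∀ j, ∑ x, u j x ≤ 1) (l : Fin (n + 1)) :
    ∑ x, √(∑ i with i l = x, (‖a i‖ * ∏ j, u j (i j) ^ α j) ^ 2) ≤ (16 / 9) ^ n * M := by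
  set b : (Fin (n + 1) → Fin N) → 𝕜 := fun i => a i * ∏ j, ((u j (i j) ^ α j : ℝ) : 𝕜) with hb
  have hbn : ∀ i, ‖a i‖ * ∏ j, u j (i j) ^ α j = ‖b i‖ := by
    intro i
    simp only [hb, norm_mul, norm_prod, RCLike.norm_ofReal]
    congr 1
    exact prod_congr rfl fun j _ => (abs_of_nonneg (Real.rpow_nonneg (hu0 _ _) _)).symm
  have h1 : ∀ x, √(∑ i with i l = x, (‖a i‖ * ∏ j, u j (i j) ^ α j) ^ 2) ≤ (16 / 9) ^ n *
      𝔼 ε : Fin n → Fin N → ℤˣ,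
        ‖∑ i' : Fin n → Fin N, b (l.insertNth x i') * ∏ j, ((ε j (i' j) : ℤ) : 𝕜)‖ := by
    intro x
    rw [sum_filter_apply_eq_sum_insertNth]
    simp only [hbn]
    exact sqrt_sum_norm_sq_le_expect_norm_chaos _
  refine (sum_le_sum fun x _ => h1 x).trans ?_
  rw [← mul_sum, ← Finset.expect_sum_comm]
  refine mul_le_mul_of_nonneg_left ?_ (by positivity)
  refine Finset.expect_le univ_nonempty fun ε _ => ?_
  set w : Fin N → 𝕜 := fun x =>
    ∑ i' : Fin n → Fin N, b (l.insertNth x i') * ∏ j, ((ε j (i' j) : ℤ) : 𝕜) with hw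
  choose θ hθ1 hθ2 using fun x => RCLike.exists_norm_eq_mul_self (w x)
  let z : Fin (n + 1) → Fin N → 𝕜 :=
    Fin.insertNth (α := fun _ => Fin N → 𝕜) l θ fun j x => ((ε j x : ℤ) : 𝕜)
  have hz : ∀ j x, ‖z j x‖ ≤ 1 := by
    intro j x
    induction j using Fin.succAboveCases l with
    | x => simp [z, hθ1]
    | p j =>
      simp only [z, Fin.insertNth_apply_succAbove]
      rcases Int.units_eq_one_or (ε j x) with h | h <;> simp [h]
  have h2 := h u z hu0 hu1 hz
  have h3 : ∑ i, a i * ∏ j, (((u j (i j) ^ α j : ℝ) : 𝕜) * z j (i j)) =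
      ((∑ x, ‖w x‖ : ℝ) : 𝕜) := by
    push_cast
    rw [← (Fin.insertNthEquiv (fun _ => Fin N) l).sum_comp, Fintype.sum_prod_type]
    refine sum_congr rfl fun x _ => ?_
    refine Eq.trans ?_ (hθ2 x).symm
    rw [hw, mul_sum]
    refine sum_congr rfl fun i' _ => ?_
    change a (l.insertNth x i') * ∏ j, (((u j (l.insertNth (α := fun _ => Fin N) x i' j) ^ α j : ℝ)
      : 𝕜) * z j (l.insertNth (α := fun _ => Fin N) x i' j)) = _
    simp only [prod_mul_distrib, hb]
    rw [Fin.prod_univ_succAbove (fun j => z j _) l]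
    simp only [z, Fin.insertNth_apply_succAbove, Fin.insertNth_apply_same]
    ring
  rw [h3, RCLike.norm_ofReal] at h2
  exact (le_abs_self _).trans h2

/-! ### Slice norms and interpolation -/

/-- The `ℓ₂`-norm of the slice of `a` on which the `l`-th index is `x`. -/
noncomputable def sliceNorm {k N : ℕ} (a : (Fin k → Fin N) → 𝕜) (l : Fin k) (x : Fin N) : ℝ :=
  √(∑ i with i l = x, ‖a i‖ ^ 2)

theorem sliceNorm_nonneg {k N : ℕ} (a : (Fin k → Fin N) → 𝕜) (l : Fin k) (x : Fin N) :
    0 ≤ sliceNorm a l x := Real.sqrt_nonneg _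

theorem sliceNorm_sq {k N : ℕ} (a : (Fin k → Fin N) → 𝕜) (l : Fin k) (x : Fin N) :
    sliceNorm a l x ^ 2 = ∑ i with i l = x, ‖a i‖ ^ 2 :=
  Real.sq_sqrt (sum_nonneg fun _ _ => by positivity)

theorem sliceNorm_pos {k N : ℕ} {a : (Fin k → Fin N) → 𝕜} {i : Fin k → Fin N} (hi : a i ≠ 0)
    (l : Fin k) : 0 < sliceNorm a l (i l) := by
  apply Real.sqrt_pos.2
  refine sum_pos' (fun _ _ => by positivity) ⟨i, by simp, by positivity⟩

theorem sum_norm_sq_mul_sliceNorm_rpow {k N : ℕ} (a : (Fin k → Fin N) → 𝕜) (l : Fin k) {r : ℝ}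
    (hr : r ≠ 0) :
    ∑ i, ‖a i‖ ^ 2 * sliceNorm a l (i l) ^ (r - 2) = ∑ x, sliceNorm a l x ^ r := by
  rw [← sum_fiberwise univ (fun i : Fin k → Fin N => i l)]
  refine sum_congr rfl fun x _ => ?_
  have : ∑ i with i l = x, ‖a i‖ ^ 2 * sliceNorm a l (i l) ^ (r - 2) =
      ∑ i with i l = x, ‖a i‖ ^ 2 * sliceNorm a l x ^ (r - 2) :=
    sum_congr rfl fun i hi => by rw [(mem_filter.1 hi).2]
  rw [this, ← sum_mul, ← sliceNorm_sq]
  rcases (sliceNorm_nonneg a l x).eq_or_lt with h | h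
  · rw [← h, Real.zero_rpow hr]; simp
  · rw [← Real.rpow_natCast, ← Real.rpow_add h]; congr 1; push_cast; ring

/-- Cauchy–Schwarz on each slice produces the slice norm as one factor, which the inverse cancels.
-/
theorem sum_mul_sliceNorm_inv_le {k N : ℕ} (a : (Fin k → Fin N) → 𝕜) (l : Fin k)
    (P : (Fin k → Fin N) → ℝ) :
    ∑ i, ‖a i‖ ^ 2 * P i * (sliceNorm a l (i l))⁻¹ ≤
      ∑ x, √(∑ i with i l = x, (‖a i‖ * P i) ^ 2) := by
  rw [← sum_fiberwise univ (fun i : Fin k → Fin N => i l)]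
  refine sum_le_sum fun x _ => ?_
  have : ∑ i with i l = x, ‖a i‖ ^ 2 * P i * (sliceNorm a l (i l))⁻¹ =
      ∑ i with i l = x, ‖a i‖ * (‖a i‖ * P i) * (sliceNorm a l x)⁻¹ :=
    sum_congr rfl fun i hi => by rw [(mem_filter.1 hi).2]; ring
  rw [this, ← sum_mul]
  have h := Real.sum_mul_le_sqrt_mul_sqrt (univ.filter fun i : Fin k → Fin N => i l = x)
    (fun i => ‖a i‖) (fun i => ‖a i‖ * P i)
  rw [← div_eq_mul_inv]
  exact div_le_of_le_mul₀ (sliceNorm_nonneg _ _ _) (Real.sqrt_nonneg _)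
    (h.trans_eq (mul_comm _ _))

/-- Weighted AM–GM for the numbers Q / sⱼ, where Q = ∏ sⱼ ^ (r αⱼ). The weights r αⱼ, with 2 - r
added at `l`, sum to 1 since r ∑ αⱼ = r - 1, and they make the geometric mean s_l ^ (r - 2). -/
theorem norm_sq_mul_sliceNorm_rpow_le {k N : ℕ} (a : (Fin k → Fin N) → 𝕜) {α : Fin k → ℝ}
    (hα : ∀ j, 0 ≤ α j) {r : ℝ} (hr1 : 0 ≤ r) (hr2 : r ≤ 2) (hr : r * ∑ j, α j = r - 1)
    (l : Fin k) (i : Fin k → Fin N) :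
    ‖a i‖ ^ 2 * sliceNorm a l (i l) ^ (r - 2) ≤
      ∑ j, (r * α j + if j = l then 2 - r else 0) *
        (‖a i‖ ^ 2 * (∏ j, sliceNorm a j (i j) ^ (r * α j)) * (sliceNorm a j (i j))⁻¹) := by
  rcases eq_or_ne (a i) 0 with h0 | h0
  · simp [h0]
  have hS := fun j => sliceNorm_pos h0 j
  set s : Fin k → ℝ := fun j => sliceNorm a j (i j) with hs
  set Q := ∏ j, s j ^ (r * α j) with hQ
  have hQ0 : 0 < Q := prod_pos fun j _ => Real.rpow_pos_of_pos (hS j) _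
  set θ : Fin k → ℝ := fun j => r * α j + if j = l then 2 - r else 0 with hθ
  have hθ0 : ∀ j, 0 ≤ θ j := fun j => by
    have := mul_nonneg hr1 (hα j)
    simp only [hθ]; split_ifs <;> linarith
  have hθ1 : ∑ j, θ j = 1 := by
    simp only [hθ, sum_add_distrib, ← mul_sum, hr]
    simp
    norm_num
  have h := Real.geom_mean_le_arith_mean_weighted univ θ (fun j => Q * (s j)⁻¹)
    (fun j _ => hθ0 j) hθ1 fun j _ => by have := hS j; positivity
  have e : ∏ j, (Q * (s j)⁻¹) ^ θ j = s l ^ (r - 2) := by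
    have : ∀ j, (Q * (s j)⁻¹) ^ θ j = Q ^ θ j * s j ^ (- θ j) := fun j => by
      rw [Real.mul_rpow hQ0.le (inv_nonneg.2 (hS j).le), Real.inv_rpow (hS j).le,
        Real.rpow_neg (hS j).le]
    simp only [this]
    rw [prod_mul_distrib, ← Real.rpow_sum_of_pos hQ0, hθ1, Real.rpow_one, hQ, ← prod_mul_distrib]
    rw [prod_eq_single l]
    · rw [← Real.rpow_add (hS l)]; congr 1; simp [hθ]
    · intro j _ hj
      rw [← Real.rpow_add (hS j)]; simp [hθ, hj]
    · simp
  rw [e] at h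
  calc ‖a i‖ ^ 2 * s l ^ (r - 2) ≤ ‖a i‖ ^ 2 * ∑ j, θ j * (Q * (s j)⁻¹) := by gcongr
    _ = _ := by
      rw [mul_sum]; exact sum_congr rfl fun j _ => by ring

/-- A self-improving bound: the weights Sⱼ ^ r / L, with L the largest of the sums, turn the
hypothesis into L ≤ L ^ A. Since A < 1, this excludes L > 1. -/
theorem sum_sliceNorm_rpow_le_one {k N : ℕ} (a : (Fin k → Fin N) → 𝕜) {α : Fin k → ℝ}
    (hα : ∀ j, 0 ≤ α j) (hA : ∑ j, α j ≤ 1 / 2)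
    (H : ∀ u : Fin k → Fin N → ℝ, (∀ j x, 0 ≤ u j x) → (∀ j, ∑ x, u j x ≤ 1) → ∀ l,
      ∑ x, √(∑ i with i l = x, (‖a i‖ * ∏ j, u j (i j) ^ α j) ^ 2) ≤ 1) (l : Fin k) :
    ∑ x, sliceNorm a l x ^ (1 / (1 - ∑ j, α j)) ≤ 1 := by
  set A := ∑ j, α j with hAdef
  have hA0 : 0 ≤ A := sum_nonneg fun j _ => hα j
  set r := 1 / (1 - A) with hr
  have hr1 : 1 ≤ r := by rw [hr, le_div_iff₀ (by linarith)]; linarith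
  have hr2 : r ≤ 2 := by rw [hr, div_le_iff₀ (by linarith)]; linarith
  have hrA : r * A = r - 1 := by
    have : 1 - A ≠ 0 := by linarith
    rw [hr]; field_simp; ring
  have : Nonempty (Fin k) := ⟨l⟩
  -- Maximality makes the normalisation by L admissible in all directions at once.
  obtain ⟨l₀, hl₀⟩ := Finite.exists_max fun l => ∑ x, sliceNorm a l x ^ r
  refine (hl₀ l).trans ?_
  set L := ∑ x, sliceNorm a l₀ x ^ r with hL
  by_contra! hL1
  have hL0 : 0 < L := by linarith
  have hS := sliceNorm_nonneg a
  set Q : (Fin k → Fin N) → ℝ := fun i => ∏ j, sliceNorm a j (i j) ^ (r * α j) with hQ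
  have hG : ∀ j, ∑ i, ‖a i‖ ^ 2 * Q i * (sliceNorm a j (i j))⁻¹ ≤ L ^ A := by
    intro l
    have h1 := (sum_mul_sliceNorm_inv_le a l _).trans
      (H (fun j x => sliceNorm a j x ^ r / L)
        (fun j x => div_nonneg (Real.rpow_nonneg (hS _ _) _) hL0.le)
        (fun j => by rw [← sum_div]; exact (div_le_one hL0).2 (hl₀ j)) l)
    have h2 : ∀ i : Fin k → Fin N,
        ∏ j, (sliceNorm a j (i j) ^ r / L) ^ α j = Q i / L ^ A := by
      intro i
      rw [hAdef, Real.rpow_sum_of_pos hL0, hQ, ← prod_div_distrib]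
      refine prod_congr rfl fun j _ => ?_
      rw [Real.div_rpow (Real.rpow_nonneg (hS _ _) _) hL0.le, ← Real.rpow_mul (hS _ _)]
    simp only [h2] at h1
    have h3 : ∀ i, ‖a i‖ ^ 2 * (Q i / L ^ A) * (sliceNorm a l (i l))⁻¹ =
        (‖a i‖ ^ 2 * Q i * (sliceNorm a l (i l))⁻¹) / L ^ A := fun i => by ring
    simp only [h3, ← sum_div] at h1
    exact (div_le_one (Real.rpow_pos_of_pos hL0 _)).1 h1
  have h4 : L ≤ L ^ A := by
    calc L = ∑ i, ‖a i‖ ^ 2 * sliceNorm a l₀ (i l₀) ^ (r - 2) :=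
          (sum_norm_sq_mul_sliceNorm_rpow a l₀ (by linarith)).symm
      _ ≤ ∑ i, ∑ j, (r * α j + if j = l₀ then 2 - r else 0) *
            (‖a i‖ ^ 2 * Q i * (sliceNorm a j (i j))⁻¹) :=
          sum_le_sum fun i _ => norm_sq_mul_sliceNorm_rpow_le a hα (by linarith) hr2 hrA l₀ i
      _ = ∑ j, (r * α j + if j = l₀ then 2 - r else 0) *
            ∑ i, (‖a i‖ ^ 2 * Q i * (sliceNorm a j (i j))⁻¹) := by
          rw [sum_comm]; simp only [mul_sum]
      _ ≤ ∑ j, (r * α j + if j = l₀ then 2 - r else 0) * L ^ A := by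
          refine sum_le_sum fun j _ => mul_le_mul_of_nonneg_left (hG j) ?_
          have := mul_nonneg (by linarith : 0 ≤ r) (hα j)
          split_ifs <;> linarith
      _ = L ^ A := by
          rw [← sum_mul, sum_add_distrib, ← mul_sum, ← hAdef, hrA]
          simp
          norm_num
  have h5 : L ^ A < L ^ (1 : ℝ) := Real.rpow_lt_rpow_of_exponent_lt hL1 (by linarith)
  rw [Real.rpow_one] at h5
  linarith

/-- Interpolation of mixed norms (Blei's inequality). -/
theorem sum_norm_rpow_le_one_of_sum_sliceNorm {k N : ℕ} (hk : 0 < k) (a : (Fin k → Fin N) → 𝕜)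
    {A : ℝ} (hA0 : 0 ≤ A) (hA : A ≤ 1 / 2)
    (H : ∀ l, ∑ x, sliceNorm a l x ^ (1 / (1 - A)) ≤ 1) :
    ∑ i, ‖a i‖ ^ (2 * (k : ℝ) / (k + 1 - 2 * A)) ≤ 1 := by
  have hk' : (1 : ℝ) ≤ k := by exact_mod_cast hk
  set r := 1 / (1 - A) with hr
  have hr1 : 1 ≤ r := by rw [hr, le_div_iff₀ (by linarith)]; linarith
  set q := 2 * (k : ℝ) / (k + 1 - 2 * A) with hq
  have hD : 0 < (k : ℝ) + 1 - 2 * A := by linarith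
  have hq0 : 0 < q := by positivity
  have hq2 : q ≤ 2 := by rw [hq, div_le_iff₀ hD]; linarith
  -- This identity determines q: it says that every slice norm cancels in the geometric mean below,
  -- leaving only ‖a i‖ ^ q.
  have hexp : (r - 2) / k * (q / 2) + r * (1 - q / 2) = 0 := by
    have h1 : r - 2 = r * (2 * A - 1) := by
      have : r * (1 - A) = 1 := one_div_mul_cancel (by linarith)
      linarith
    have h2 : q / 2 = k / (k + 1 - 2 * A) := by rw [hq]; ring
    have h3 : 1 - q / 2 = (1 - 2 * A) / (k + 1 - 2 * A) := by
      rw [h2, eq_div_iff hD.ne', sub_mul, div_mul_cancel₀ _ hD.ne']; ring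
    rw [h3, h2, h1]
    field_simp
    ring
  -- Of the two terms on the right, the first sums to a mean of the slice sums over the k
  -- directions, and the second to their product.
  have hpt : ∀ i, ‖a i‖ ^ q ≤
      q / 2 * (∑ j, 1 / (k : ℝ) * (‖a i‖ ^ 2 * sliceNorm a j (i j) ^ (r - 2))) +
        (1 - q / 2) * ∏ j, sliceNorm a j (i j) ^ r := by
    intro i
    rcases eq_or_ne (a i) 0 with h0 | h0
    · simp only [h0, norm_zero, Real.zero_rpow hq0.ne']
      have : 0 ≤ ∏ j, sliceNorm a j (i j) ^ r :=
        prod_nonneg fun j _ => Real.rpow_nonneg (sliceNorm_nonneg _ _ _) _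
      have := mul_nonneg (by linarith : 0 ≤ 1 - q / 2) this
      simpa using this
    have hS := fun j => sliceNorm_pos h0 j
    have ha : 0 < ‖a i‖ := norm_pos_iff.2 h0
    have h1 := Real.geom_mean_le_arith_mean_weighted univ (fun _ : Fin k => 1 / (k : ℝ))
      (fun j => sliceNorm a j (i j) ^ (r - 2)) (fun j _ => by positivity)
      (by simp; field_simp) (fun j _ => (Real.rpow_pos_of_pos (hS j) _).le)
    set g := ∏ j, (sliceNorm a j (i j) ^ (r - 2)) ^ (1 / (k : ℝ)) with hg
    have hg0 : 0 ≤ g :=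
      prod_nonneg fun j _ => Real.rpow_nonneg (Real.rpow_pos_of_pos (hS j) _).le _
    have hP0 : 0 ≤ ∏ j, sliceNorm a j (i j) ^ r :=
      prod_nonneg fun j _ => (Real.rpow_pos_of_pos (hS j) _).le
    have h2 := Real.geom_mean_le_arith_mean2_weighted (w₁ := q / 2) (w₂ := 1 - q / 2)
      (p₁ := ‖a i‖ ^ 2 * g) (p₂ := ∏ j, sliceNorm a j (i j) ^ r) (by positivity) (by linarith)
      (by positivity) hP0 (by ring)
    have e : (‖a i‖ ^ 2 * g) ^ (q / 2) * (∏ j, sliceNorm a j (i j) ^ r) ^ (1 - q / 2) =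
        ‖a i‖ ^ q := by
      rw [Real.mul_rpow (by positivity) hg0, hg,
        ← Real.finsetProd_rpow _ _ (fun j _ => Real.rpow_nonneg (Real.rpow_pos_of_pos (hS j) _).le _),
        ← Real.finsetProd_rpow _ _ (fun j _ => (Real.rpow_pos_of_pos (hS j) _).le), mul_assoc,
        ← prod_mul_distrib, prod_eq_one, mul_one, ← Real.rpow_natCast, ← Real.rpow_mul ha.le]
      · congr 1; push_cast; ring
      · intro j _
        rw [← Real.rpow_mul (hS j).le, ← Real.rpow_mul (hS j).le, ← Real.rpow_mul (hS j).le,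
          ← Real.rpow_add (hS j)]
        have : (r - 2) * (1 / (k : ℝ)) * (q / 2) + r * (1 - q / 2) = 0 := by
          rw [← hexp]; ring
        rw [this, Real.rpow_zero]
    rw [e] at h2
    refine h2.trans ?_
    gcongr
    calc ‖a i‖ ^ 2 * g ≤ ‖a i‖ ^ 2 * ∑ j, 1 / (k : ℝ) * sliceNorm a j (i j) ^ (r - 2) := by gcongr
      _ = _ := by rw [mul_sum]; exact sum_congr rfl fun j _ => by ring
  refine (sum_le_sum fun i _ => hpt i).trans ?_
  rw [sum_add_distrib, ← mul_sum, ← mul_sum, sum_comm]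
  have h1 : ∑ j, ∑ i, 1 / (k : ℝ) * (‖a i‖ ^ 2 * sliceNorm a j (i j) ^ (r - 2)) ≤ 1 := by
    calc _ = ∑ j, 1 / (k : ℝ) * ∑ x, sliceNorm a j x ^ r := by
          refine sum_congr rfl fun j _ => ?_
          rw [← mul_sum, sum_norm_sq_mul_sliceNorm_rpow a j (by linarith)]
      _ ≤ ∑ j : Fin k, 1 / (k : ℝ) * 1 :=
          sum_le_sum fun j _ => mul_le_mul_of_nonneg_left (H j) (by positivity)
      _ = 1 := by simp; field_simp
  have h2 : ∑ i : Fin k → Fin N, ∏ j, sliceNorm a j (i j) ^ r ≤ 1 := by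
    have := prod_univ_sum (fun _ : Fin k => (univ : Finset (Fin N)))
      (fun j x => sliceNorm a j x ^ r)
    rw [Fintype.piFinset_univ] at this
    rw [← this]
    exact prod_le_one (fun j _ => sum_nonneg fun x _ => Real.rpow_nonneg (sliceNorm_nonneg _ _ _) _)
      fun j _ => H j
  have := mul_le_mul_of_nonneg_left h1 (by positivity : 0 ≤ q / 2)
  have := mul_le_mul_of_nonneg_left h2 (by linarith : 0 ≤ 1 - q / 2)
  linarith

/-! ### Duality, scaling and exponent sums above one half -/

/-- A nonnegative form that is bounded by `1` on the product of the unit balls of `ℓ_{1/γⱼ}` has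
its coefficients in the unit ball of `ℓ_{1/(1 - ∑ γⱼ)}`. -/
theorem sum_rpow_le_one_of_forall_sum_mul_le_one {k N : ℕ} {b : (Fin k → Fin N) → ℝ}
    (hb : ∀ i, 0 ≤ b i) {γ : Fin k → ℝ} (hγ : ∀ j, 0 ≤ γ j) (hγ1 : ∑ j, γ j < 1)
    (H : ∀ u : Fin k → Fin N → ℝ, (∀ j x, 0 ≤ u j x) → (∀ j, ∑ x, u j x ≤ 1) →
      ∑ i, b i * ∏ j, u j (i j) ^ γ j ≤ 1) :
    ∑ i, b i ^ (1 / (1 - ∑ j, γ j)) ≤ 1 := by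
  set δ := ∑ j, γ j with hδ
  have hδ0 : 0 ≤ δ := sum_nonneg fun j _ => hγ j
  set t := 1 / (1 - δ) with ht
  have ht0 : 0 < t := by rw [ht]; exact div_pos one_pos (by linarith)
  have htδ : 1 + t * δ = t := by
    have : 1 - δ ≠ 0 := by linarith
    rw [ht]; field_simp; ring
  have hbt : ∀ i, 0 ≤ b i ^ t := fun i => Real.rpow_nonneg (hb i) _
  set Z := ∑ i, b i ^ t with hZ
  by_contra! hZ1
  have hZ0 : 0 < Z := by linarith
  -- The test weights are the marginals of b ^ t / Z. Each marginal dominates the single term at i,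
  -- so the product of their powers is at least (b i ^ t / Z) ^ δ; with 1 + tδ = t this gives Z ≤ Z
  -- ^ δ.
  have h := H (fun j x => (∑ i with i j = x, b i ^ t) / Z)
    (fun j x => div_nonneg (sum_nonneg fun i _ => hbt i) hZ0.le)
    (fun j => by rw [← sum_div, sum_fiberwise, div_self hZ0.ne'])
  have h2 : Z / Z ^ δ ≤ 1 := by
    refine le_trans ?_ h
    rw [hZ, sum_div, ← hZ]
    refine sum_le_sum fun i _ => ?_
    rcases (hb i).eq_or_lt with h0 | h0
    · rw [← h0, Real.zero_rpow ht0.ne']; simp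
    have : (b i ^ t / Z) ^ δ ≤ ∏ j, ((∑ i' with i' j = i j, b i' ^ t) / Z) ^ γ j := by
      rw [hδ, Real.rpow_sum_of_pos (by positivity)]
      refine prod_le_prod (fun j _ => by positivity) fun j _ => ?_
      refine Real.rpow_le_rpow (by positivity) ?_ (hγ j)
      gcongr
      exact single_le_sum (f := fun i => b i ^ t) (fun i _ => hbt i) (by simp)
    refine le_trans (le_of_eq ?_) (mul_le_mul_of_nonneg_left this (hb i))
    rw [Real.div_rpow (hbt i) hZ0.le, ← Real.rpow_mul h0.le, ← mul_div_assoc]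
    congr 1
    nth_rewrite 2 [← Real.rpow_one (b i)]
    rw [← Real.rpow_add h0, htδ]
  rw [div_le_one (Real.rpow_pos_of_pos hZ0 _)] at h2
  have h5 : Z ^ δ < Z ^ (1 : ℝ) := Real.rpow_lt_rpow_of_exponent_lt hZ1 (by linarith)
  rw [Real.rpow_one] at h5
  linarith

theorem FormBound.const_mul {k N : ℕ} {a : (Fin k → Fin N) → 𝕜} {α : Fin k → ℝ} {M : ℝ}
    (h : FormBound a α M) (c : 𝕜) : FormBound (fun i => c * a i) α (‖c‖ * M) := by
  intro u z hu0 hu1 hz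
  simp only [mul_assoc, ← mul_sum, norm_mul]
  exact mul_le_mul_of_nonneg_left (h u z hu0 hu1 hz) (norm_nonneg _)

theorem FormBound.mono {k N : ℕ} {a : (Fin k → Fin N) → 𝕜} {α : Fin k → ℝ} {M M' : ℝ}
    (h : FormBound a α M) (hM : M ≤ M') : FormBound a α M' :=
  fun u z hu0 hu1 hz => (h u z hu0 hu1 hz).trans hM

theorem FormBound.rpow_sum_le {k N : ℕ} {a : (Fin k → Fin N) → 𝕜} {α : Fin k → ℝ} {M q C : ℝ}
    (hq : 0 < q) (hC : 0 < C)
    (H : ∀ a' : (Fin k → Fin N) → 𝕜, FormBound a' α C⁻¹ → ∑ i, ‖a' i‖ ^ q ≤ 1) (hM : 0 ≤ M)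
    (h : FormBound a α M) : (∑ i, ‖a i‖ ^ q) ^ (1 / q) ≤ C * M := by
  refine le_of_forall_pos_le_add fun ε hε => ?_
  -- The summand ε keeps the scaling factor invertible when M = 0.
  set R := C * M + ε with hR
  have hR0 : 0 < R := by positivity
  have hM' : M ≤ R / C := by
    rw [le_div_iff₀ hC]; linarith
  have hn : ‖((R⁻¹ : ℝ) : 𝕜)‖ = R⁻¹ := by
    rw [RCLike.norm_ofReal, abs_of_pos (inv_pos.2 hR0)]
  have h1 := (h.mono hM').const_mul ((R⁻¹ : ℝ) : 𝕜)
  rw [hn, div_eq_mul_inv, inv_mul_cancel_left₀ hR0.ne'] at h1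
  have h2 := H _ h1
  simp only [norm_mul, hn] at h2
  have h3 : ∀ i, (R⁻¹ * ‖a i‖) ^ q = ‖a i‖ ^ q / R ^ q := fun i => by
    rw [Real.mul_rpow (inv_pos.2 hR0).le (norm_nonneg _), Real.inv_rpow hR0.le]; ring
  simp only [h3, ← sum_div] at h2
  rw [div_le_one (Real.rpow_pos_of_pos hR0 _)] at h2
  rw [one_div]
  exact (Real.rpow_inv_le_iff_of_pos (sum_nonneg fun _ _ => by positivity) hR0.le hq).2 h2

theorem FormBound.sum_norm_rpow_le_one_of_le_half {n N : ℕ} {a : (Fin (n + 1) → Fin N) → 𝕜}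
    {α : Fin (n + 1) → ℝ} (hα : ∀ j, 0 ≤ α j) (hA : ∑ j, α j ≤ 1 / 2)
    (h : FormBound a α ((16 / 9) ^ n)⁻¹) :
    ∑ i, ‖a i‖ ^ (2 * ((n + 1 : ℕ) : ℝ) / ((n + 1 : ℕ) + 1 - 2 * ∑ j, α j)) ≤ 1 := by
  refine sum_norm_rpow_le_one_of_sum_sliceNorm n.succ_pos a (sum_nonneg fun j _ => hα j) hA
    (sum_sliceNorm_rpow_le_one a hα hA fun u hu0 hu1 l => ?_)
  refine (h.sum_sqrt_le hu0 hu1 l).trans_eq (mul_inv_cancel₀ (by positivity))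

/-- By AM–GM, u ^ (1 - θ) · v ^ θ is again an admissible weight, so the factor carrying u can be
moved into the coefficients. -/
theorem FormBound.mul_prod_rpow {k N : ℕ} {a : (Fin k → Fin N) → 𝕜} {α : Fin k → ℝ} {M : ℝ}
    (h : FormBound a α M) {θ : ℝ} (h0 : 0 ≤ θ) (h1 : θ ≤ 1) {u : Fin k → Fin N → ℝ}
    (hu0 : ∀ j x, 0 ≤ u j x) (hu1 : ∀ j, ∑ x, u j x ≤ 1) :
    FormBound (fun i => a i * ∏ j, ((u j (i j) ^ ((1 - θ) * α j) : ℝ) : 𝕜)) (fun j => θ * α j) M := by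
  intro v z hv0 hv1 hz
  have := h (fun j x => u j x ^ (1 - θ) * v j x ^ θ) z
    (fun j x => mul_nonneg (Real.rpow_nonneg (hu0 _ _) _) (Real.rpow_nonneg (hv0 _ _) _))
    (fun j => by
      calc ∑ x, u j x ^ (1 - θ) * v j x ^ θ ≤ ∑ x, ((1 - θ) * u j x + θ * v j x) :=
            sum_le_sum fun x _ => Real.geom_mean_le_arith_mean2_weighted (by linarith) h0
              (hu0 _ _) (hv0 _ _) (by ring)
        _ ≤ 1 := by
            rw [sum_add_distrib, ← mul_sum, ← mul_sum]
            nlinarith [hu1 j, hv1 j]) hz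
  refine le_trans (le_of_eq ?_) this
  congr 1
  refine sum_congr rfl fun i _ => ?_
  rw [mul_assoc, ← prod_mul_distrib]
  congr 1
  refine prod_congr rfl fun j _ => ?_
  rw [Real.mul_rpow (Real.rpow_nonneg (hu0 _ _) _) (Real.rpow_nonneg (hv0 _ _) _),
    ← Real.rpow_mul (hu0 _ _), ← Real.rpow_mul (hv0 _ _)]
  push_cast
  ring

theorem FormBound.sum_norm_rpow_le_one_of_half_le {n N : ℕ} {a : (Fin (n + 1) → Fin N) → 𝕜}
    {α : Fin (n + 1) → ℝ} (hα : ∀ j, 0 ≤ α j) (hA : 1 / 2 ≤ ∑ j, α j) (hA1 : ∑ j, α j < 1)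
    (h : FormBound a α ((16 / 9) ^ n)⁻¹) :
    ∑ i, ‖a i‖ ^ (1 / (1 - ∑ j, α j)) ≤ 1 := by
  set A := ∑ j, α j with hAdef
  have hA0 : 0 < A := by linarith
  -- This θ brings the remaining exponents to sum 1/2, where the previous case is an ℓ₂ bound.
  -- Duality for ‖a i‖ ^ 2 with the frozen exponents, doubled and of sum 2A - 1, gives the power
  -- 1/(2 - 2A) of the squares.
  set θ := 1 / (2 * A) with hθ
  have hθ0 : 0 ≤ θ := by positivity
  have hθ1 : θ ≤ 1 := by rw [hθ, div_le_one (by positivity)]; linarith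
  have hθA : θ * A = 1 / 2 := by rw [hθ]; field_simp
  have hsum : ∑ j, 2 * ((1 - θ) * α j) = 2 * A - 1 := by
    rw [← mul_sum, ← mul_sum, ← hAdef]; linarith
  have key := sum_rpow_le_one_of_forall_sum_mul_le_one (b := fun i => ‖a i‖ ^ 2)
    (fun i => by positivity) (γ := fun j => 2 * ((1 - θ) * α j))
    (fun j => by have := hα j; have : 0 ≤ 1 - θ := by linarith
                 positivity)
    (by rw [hsum]; linarith)
    (fun u hu0 hu1 => by
      have h1 := (h.mul_prod_rpow hθ0 hθ1 hu0 hu1).sum_norm_rpow_le_one_of_le_half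
        (fun j => mul_nonneg hθ0 (hα j)) (by rw [← mul_sum, ← hAdef, hθA])
      rw [← mul_sum, ← hAdef, hθA] at h1
      have e : 2 * ((n + 1 : ℕ) : ℝ) / ((n + 1 : ℕ) + 1 - 2 * (1 / 2)) = 2 := by
        rw [div_eq_iff (by push_cast; linarith [(n.cast_nonneg : (0 : ℝ) ≤ n)])]; ring
      rw [e] at h1
      refine le_trans (le_of_eq (sum_congr rfl fun i _ => ?_)) h1
      rw [norm_mul, norm_prod, Real.rpow_two, mul_pow, ← prod_pow]
      congr 1
      refine prod_congr rfl fun j _ => ?_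
      rw [RCLike.norm_ofReal, abs_of_nonneg (Real.rpow_nonneg (hu0 _ _) _), ← Real.rpow_natCast,
        ← Real.rpow_mul (hu0 _ _)]
      congr 1
      push_cast
      ring)
  rw [hsum] at key
  refine le_trans (le_of_eq (sum_congr rfl fun i _ => ?_)) key
  rw [← Real.rpow_natCast, ← Real.rpow_mul (norm_nonneg _)]
  congr 1
  have : 1 - A ≠ 0 := by linarith
  rw [show 1 - (2 * A - 1) = 2 * (1 - A) by ring]
  push_cast
  field_simp

/-! ### Restriction to diagonals by averaging over signs -/

theorem sum_units_mul_units {N : ℕ} (x y : Fin N) :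
    ∑ η : Fin N → ℤˣ, (((η x : ℤ) : 𝕜) * ((η y : ℤ) : 𝕜)) =
      if x = y then (Fintype.card (Fin N → ℤˣ) : 𝕜) else 0 := by
  split_ifs with h
  · subst h
    rw [sum_congr rfl (g := fun _ => (1 : 𝕜)), sum_const, nsmul_one, card_univ]
    intro η _
    rcases Int.units_eq_one_or (η x) with h | h <;> simp [h]
  -- Flipping the sign at x permutes the sign vectors and negates the summand, so the sum vanishes.
  · have := Equiv.sum_comp (Equiv.mulLeft (Pi.mulSingle x (-1 : ℤˣ) : Fin N → ℤˣ))
      fun η : Fin N → ℤˣ => (((η x : ℤ) : 𝕜) * ((η y : ℤ) : 𝕜))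
    simp only [Equiv.coe_mulLeft, Pi.mul_apply, Pi.mulSingle_eq_same,
      Pi.mulSingle_eq_of_ne (Ne.symm h)] at this
    simp only [neg_mul, one_mul, Units.val_neg, Int.cast_neg, sum_neg_distrib] at this
    exact self_eq_neg.1 this.symm

theorem sum_prod_units_mul_units {m N : ℕ} (i i' : Fin m → Fin N) :
    ∑ η : Fin m → Fin N → ℤˣ, ∏ j, (((η j (i j) : ℤ) : 𝕜) * ((η j (i' j) : ℤ) : 𝕜)) =
      if i = i' then (Fintype.card (Fin N → ℤˣ) : 𝕜) ^ m else 0 := by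
  have := prod_univ_sum (fun _ : Fin m => (univ : Finset (Fin N → ℤˣ)))
    (fun j (η : Fin N → ℤˣ) => (((η (i j) : ℤ) : 𝕜) * ((η (i' j) : ℤ) : 𝕜)))
  rw [Fintype.piFinset_univ] at this
  rw [← this]
  simp only [sum_units_mul_units]
  split_ifs with h
  · simp [h]
  · obtain ⟨j, hj⟩ := Function.ne_iff.1 h
    exact prod_eq_zero (mem_univ j) (if_neg hj)

/-- Restriction of a form to the diagonals given by the blocks of `b`. -/
theorem FormBound.comp_block {m k N : ℕ} {a : (Fin m → Fin N) → 𝕜} {α : Fin m → ℝ} {M : ℝ}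
    (h : FormBound a α M) (hα : ∀ j, 0 ≤ α j) {b : Fin m → Fin k} {σ : Fin k → Fin m}
    (hσ : ∀ r, b (σ r) = r) :
    FormBound (fun i : Fin k → Fin N => a fun j => i (b j)) (fun r => ∑ j with b j = r, α j) M := by
  intro u z hu0 hu1 hz
  set Q : 𝕜 := (Fintype.card (Fin N → ℤˣ) : 𝕜) ^ m with hQ
  have hsg : ∀ s : ℤˣ, ‖((s : ℤ) : 𝕜)‖ = 1 := fun s => by
    rcases Int.units_eq_one_or s with h | h <;> simp [h]
  -- The multiplier z of a block is used only at its representative position `σ (b j)`, so that it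
  -- appears once on the diagonal.
  let w : (Fin m → Fin N) → 𝕜 := fun i => a i * ∏ j, (((u (b j) (i j) ^ α j : ℝ) : 𝕜) *
    if j = σ (b j) then z (b j) (i j) else 1)
  -- Each sign family η j' is used twice: in argument j' and in the argument representing its block.
  -- The two signs agree when the two indices do, and otherwise average to zero.
  let Z : (Fin m → Fin N → ℤˣ) → Fin m → Fin N → 𝕜 := fun η j x =>
    (if j = σ (b j) then z (b j) x else 1) *
      (((η j x : ℤ) : 𝕜) * ∏ j' with σ (b j') = j, ((η j' x : ℤ) : 𝕜))
  have h1 : ∀ η : Fin m → Fin N → ℤˣ,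
      ‖∑ i, w i * ∏ j, (((η j (i j) : ℤ) : 𝕜) * ((η j (i (σ (b j))) : ℤ) : 𝕜))‖ ≤ M := by
    intro η
    have := h (fun j => u (b j)) (Z η) (fun j x => hu0 _ _) (fun j => hu1 _) (fun j x => by
      simp only [Z, norm_mul, norm_prod, hsg, prod_const_one, mul_one]
      split_ifs
      · exact hz _ _
      · simp)
    refine le_trans (le_of_eq ?_) this
    congr 1
    refine sum_congr rfl fun i _ => ?_
    simp only [w, Z, prod_mul_distrib]
    have hf : ∏ j, ∏ j' with σ (b j') = j, ((η j' (i j) : ℤ) : 𝕜) =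
        ∏ j, ((η j (i (σ (b j))) : ℤ) : 𝕜) := by
      rw [← prod_fiberwise univ (fun j => σ (b j)) (fun j => ((η j (i (σ (b j))) : ℤ) : 𝕜))]
      refine prod_congr rfl fun j _ => prod_congr rfl fun j' hj' => ?_
      rw [(mem_filter.1 hj').2]
    rw [hf]
    ring
  -- Only the multi-indices constant on each block survive the summation over η.
  have h2 : ∑ η : Fin m → Fin N → ℤˣ,
      ∑ i, w i * ∏ j, (((η j (i j) : ℤ) : 𝕜) * ((η j (i (σ (b j))) : ℤ) : 𝕜)) =
      Q * ∑ i : Fin k → Fin N, w fun j => i (b j) := by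
    rw [sum_comm]
    simp only [← mul_sum, sum_prod_units_mul_units]
    simp only [mul_ite, mul_zero]
    rw [← sum_filter, ← sum_mul, mul_comm]
    congr 1
    refine sum_nbij' (fun i r => i (σ r)) (fun i j => i (b j)) (by simp) ?_ ?_ ?_ ?_
    · intro i _
      simp [hσ]
    · intro i hi
      exact (mem_filter.1 hi).2.symm
    · intro i _
      simp [hσ]
    · intro i hi
      exact congrArg w (mem_filter.1 hi).2
  have h3 : ∀ i : Fin k → Fin N, w (fun j => i (b j)) = a (fun j => i (b j)) *
      ∏ r, (((u r (i r) ^ (∑ j with b j = r, α j) : ℝ) : 𝕜) * z r (i r)) := by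
    intro i
    simp only [w]
    congr 1
    rw [← prod_fiberwise univ b]
    refine prod_congr rfl fun r _ => ?_
    rw [prod_mul_distrib, Real.rpow_sum_of_nonneg (hu0 _ _) (fun j _ => hα j)]
    congr 1
    · push_cast
      exact prod_congr rfl fun j hj => by rw [(mem_filter.1 hj).2]
    · rw [prod_eq_single (σ r)]
      · simp [hσ]
      · intro j hj hne
        rw [(mem_filter.1 hj).2, if_neg hne]
      · intro hn
        simp [hσ] at hn
  simp only [← h3]
  have hc : (0 : ℝ) < (Fintype.card (Fin m → Fin N → ℤˣ) : ℝ) := by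
    exact_mod_cast Fintype.card_pos
  have hQn : ‖Q‖ = (Fintype.card (Fin m → Fin N → ℤˣ) : ℝ) := by
    rw [hQ, norm_pow, RCLike.norm_natCast, Fintype.card_fun (α := Fin m), Fintype.card_fin]
    push_cast
    rfl
  refine le_of_mul_le_mul_left ?_ hc
  rw [← hQn, ← norm_mul, ← h2, hQn]
  refine (norm_sum_le_of_le _ fun η _ => h1 η).trans ?_
  rw [sum_const, nsmul_eq_mul, card_univ]

/-- The Hardy–Littlewood inequality in the case `∑ αⱼ ≤ 1/2`. -/
theorem FormBound.rpow_sum_le_of_le_half {k N : ℕ} (hk : 0 < k) {a : (Fin k → Fin N) → 𝕜}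
    {α : Fin k → ℝ} {M : ℝ} (hα : ∀ j, 0 ≤ α j) (hA : ∑ j, α j ≤ 1 / 2) (hM : 0 ≤ M)
    (h : FormBound a α M) :
    (∑ i, ‖a i‖ ^ (2 * (k : ℝ) / (k + 1 - 2 * ∑ j, α j))) ^
      (1 / (2 * (k : ℝ) / (k + 1 - 2 * ∑ j, α j))) ≤ (16 / 9) ^ (k - 1) * M := by
  obtain ⟨n, rfl⟩ : ∃ n, k = n + 1 := ⟨k - 1, by omega⟩
  refine h.rpow_sum_le ?_ (by positivity)
    (fun a' ha' => ha'.sum_norm_rpow_le_one_of_le_half hα hA) hM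
  have : (1 : ℝ) ≤ (n + 1 : ℕ) := by exact_mod_cast hk
  exact div_pos (by linarith) (by linarith)

/-- The Hardy–Littlewood inequality in the case `1/2 ≤ ∑ αⱼ < 1`. -/
theorem FormBound.rpow_sum_le_of_half_le {k N : ℕ} (hk : 0 < k) {a : (Fin k → Fin N) → 𝕜}
    {α : Fin k → ℝ} {M : ℝ} (hα : ∀ j, 0 ≤ α j) (hA : 1 / 2 ≤ ∑ j, α j) (hA1 : ∑ j, α j < 1)
    (hM : 0 ≤ M) (h : FormBound a α M) :
    (∑ i, ‖a i‖ ^ (1 / (1 - ∑ j, α j))) ^ (1 / (1 / (1 - ∑ j, α j))) ≤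
      (16 / 9) ^ (k - 1) * M := by
  obtain ⟨n, rfl⟩ : ∃ n, k = n + 1 := ⟨k - 1, by omega⟩
  exact h.rpow_sum_le (div_pos one_pos (by linarith)) (by positivity)
    (fun a' ha' => ha'.sum_norm_rpow_le_one_of_half_le hα hA hA1) hM

end Arrays

/-! ### From arrays to forms on ℓ_p spaces -/

section Lp
variable {𝕜 : Type*} [RCLike 𝕜] {N : ℕ}

theorem norm_toLp_rpow_mul_le_one (p : ℝ≥0∞) [hp : Fact (1 ≤ p)] {u : Fin N → ℝ} {z : Fin N → 𝕜}
    (hu0 : ∀ x, 0 ≤ u x) (hu1 : ∑ x, u x ≤ 1) (hz : ∀ x, ‖z x‖ ≤ 1) :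
    ‖(WithLp.toLp p (fun x => ((u x ^ (p⁻¹).toReal : ℝ) : 𝕜) * z x) :
      PiLp p (fun _ : Fin N => 𝕜))‖ ≤ 1 := by
  have hn : ∀ x, ‖((u x ^ (p⁻¹).toReal : ℝ) : 𝕜) * z x‖ ≤ u x ^ (p⁻¹).toReal := fun x => by
    have h := Real.rpow_nonneg (hu0 x) (p⁻¹).toReal
    rw [norm_mul, RCLike.norm_ofReal, abs_of_nonneg h]
    exact mul_le_of_le_one_right h (hz x)
  rcases eq_or_ne p ∞ with rfl | htop
  · rw [PiLp.norm_eq_ciSup]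
    refine Real.iSup_le (fun x => ?_) zero_le_one
    simpa using hn x
  · have hp0 : 0 < p.toReal := ENNReal.toReal_pos (by have := hp.1; positivity) htop
    rw [PiLp.norm_eq_sum hp0]
    refine Real.rpow_le_one (sum_nonneg fun _ _ => by positivity) ?_ (by positivity)
    refine le_trans (sum_le_sum fun x _ => ?_) hu1
    refine (Real.rpow_le_rpow (norm_nonneg _) (hn x) hp0.le).trans_eq ?_
    rw [← Real.rpow_mul (hu0 x), ENNReal.toReal_inv, inv_mul_cancel₀ hp0.ne', Real.rpow_one]

theorem PiLp.exists_norm_apply_le_mul_rpow (p : ℝ≥0∞) [hp : Fact (1 ≤ p)]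
    (x : PiLp p (fun _ : Fin N => 𝕜)) :
    ∃ u : Fin N → ℝ, (∀ i, 0 ≤ u i) ∧ ∑ i, u i ≤ 1 ∧
      ∀ i, ‖x i‖ ≤ ‖x‖ * u i ^ (p⁻¹).toReal := by
  rcases eq_or_ne p ∞ with rfl | htop
  -- For p = ∞ the exponent is 0 and 0 ^ 0 = 1, so the zero weight already gives the sup bound.
  · refine ⟨fun _ => 0, by simp, by simp, fun i => ?_⟩
    simpa using PiLp.norm_apply_le x i
  have hp0 : 0 < p.toReal := ENNReal.toReal_pos (by have := hp.1; positivity) htop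
  rcases eq_or_ne x 0 with rfl | hx
  · exact ⟨fun _ => 0, by simp, by simp, by simp⟩
  have hx0 : 0 < ‖x‖ := norm_pos_iff.2 hx
  refine ⟨fun i => (‖x i‖ / ‖x‖) ^ p.toReal, fun i => by positivity, le_of_eq ?_, fun i => ?_⟩
  · have h : ‖x‖ ^ p.toReal = ∑ i, ‖x i‖ ^ p.toReal := by
      rw [PiLp.norm_eq_sum hp0, ← Real.rpow_mul (sum_nonneg fun _ _ => by positivity),
        one_div_mul_cancel hp0.ne', Real.rpow_one]
    simp only [Real.div_rpow (norm_nonneg _) hx0.le]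
    rw [← sum_div, ← h, div_self (by positivity)]
  · rw [← Real.rpow_mul (by positivity), ENNReal.toReal_inv, mul_inv_cancel₀ hp0.ne',
      Real.rpow_one, mul_div_cancel₀ _ hx0.ne']

variable {m : ℕ} {p : Fin m → ℝ≥0∞} [∀ j, Fact (1 ≤ p j)]

theorem formBound_coeff
    (T : ContinuousMultilinearMap 𝕜 (fun j : Fin m => PiLp (p j) (fun _ : Fin N => 𝕜)) 𝕜) :
    FormBound (fun i : Fin m → Fin N => T fun j => canonVec 𝕜 (p j) (i j))
      (fun j => ((p j)⁻¹).toReal) ‖T‖ := by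
  intro u z hu0 hu1 hz
  let c : Fin m → Fin N → 𝕜 := fun j x => ((u j x ^ ((p j)⁻¹).toReal : ℝ) : 𝕜) * z j x
  let y : ∀ j, PiLp (p j) (fun _ : Fin N => 𝕜) := fun j => WithLp.toLp (p j) (c j)
  have hy : y = fun j => ∑ x, c j x • canonVec 𝕜 (p j) x := by
    funext j
    ext x
    simp [y, canonVec, Pi.single_apply]
  have h1 : T y = ∑ i : Fin m → Fin N, (T fun j => canonVec 𝕜 (p j) (i j)) * ∏ j, c j (i j) := by
    rw [hy, T.map_sum]
    refine sum_congr rfl fun i _ => ?_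
    rw [T.map_smul_univ (fun j => c j (i j)) (fun j => canonVec 𝕜 (p j) (i j)), smul_eq_mul,
      mul_comm]
  rw [← h1]
  refine (T.le_opNorm y).trans (mul_le_of_le_one_right (norm_nonneg _) ?_)
  exact prod_le_one (fun j _ => norm_nonneg _) fun j _ =>
    norm_toLp_rpow_mul_le_one (p j) (hu0 j) (hu1 j) (hz j)

/-! ### The diagonal form and lower bounds -/

/-- Hölder's inequality through weighted AM–GM: the missing weight 1 - A is given to the constant
1/N, indexed by `none`. -/
theorem sum_prod_rpow_le_rpow (hN : 0 < N) {α : Fin m → ℝ} (hα : ∀ j, 0 ≤ α j)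
    (hA : ∑ j, α j < 1) {u : Fin m → Fin N → ℝ} (hu0 : ∀ j x, 0 ≤ u j x)
    (hu1 : ∀ j, ∑ x, u j x ≤ 1) :
    ∑ x, ∏ j, u j x ^ α j ≤ (N : ℝ) ^ (1 - ∑ j, α j) := by
  set A := ∑ j, α j with hAdef
  have hN' : (0 : ℝ) < N := by exact_mod_cast hN
  have h : ∀ x, (N : ℝ)⁻¹ ^ (1 - A) * ∏ j, u j x ^ α j ≤ (1 - A) * (N : ℝ)⁻¹ + ∑ j, α j * u j x := by
    intro x
    have := Real.geom_mean_le_arith_mean_weighted univ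
      (fun o : Option (Fin m) => o.elim (1 - A) α)
      (fun o : Option (Fin m) => o.elim (N : ℝ)⁻¹ fun j => u j x)
      (fun o _ => by cases o <;> simp [hα]; linarith)
      (by rw [Fintype.sum_option]; simp [← hAdef])
      (fun o _ => by cases o <;> simp [hu0])
    simpa [Fintype.prod_option, Fintype.sum_option] using this
  have h1 := sum_le_sum fun x (_ : x ∈ univ) => h x
  rw [← mul_sum, sum_add_distrib, sum_comm, sum_const, card_univ, Fintype.card_fin, nsmul_eq_mul]
    at h1
  have h2 : ∑ j, ∑ x, α j * u j x ≤ A := by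
    simp only [← mul_sum]
    exact sum_le_sum fun j _ => mul_le_of_le_one_right (hα j) (hu1 j)
  have h3 : (N : ℝ) * ((1 - A) * (N : ℝ)⁻¹) = 1 - A := by field_simp
  have h4 : (N : ℝ)⁻¹ ^ (1 - A) * ∑ x, ∏ j, u j x ^ α j ≤ 1 := by linarith
  rw [Real.inv_rpow hN'.le, ← div_eq_inv_mul, div_le_one (by positivity)] at h4
  exact h4

variable (𝕜 p N) in
/-- The form `(x₁, …, xₘ) ↦ ∑ᵢ x₁(i) ⋯ xₘ(i)`. -/
noncomputable def diagForm :
    ContinuousMultilinearMap 𝕜 (fun j : Fin m => PiLp (p j) (fun _ : Fin N => 𝕜)) 𝕜 :=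
  ∑ x : Fin N, (ContinuousMultilinearMap.mkPiAlgebra 𝕜 (Fin m) 𝕜).compContinuousLinearMap
    fun j => PiLp.proj (p j) (fun _ : Fin N => 𝕜) x

omit [∀ j, Fact (1 ≤ p j)] in
theorem diagForm_apply (y : ∀ j : Fin m, PiLp (p j) (fun _ : Fin N => 𝕜)) :
    diagForm 𝕜 N p y = ∑ x, ∏ j, y j x := by
  simp [diagForm]

theorem norm_diagForm_le (hN : 0 < N) (hp : invSum p < 1) :
    ‖diagForm 𝕜 N p‖ ≤ (N : ℝ) ^ (1 - invSum p) := by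
  refine ContinuousMultilinearMap.opNorm_le_bound (by positivity) fun y => ?_
  rw [diagForm_apply]
  choose u hu0 hu1 hu using fun j => PiLp.exists_norm_apply_le_mul_rpow (p j) (y j)
  calc ‖∑ x, ∏ j, y j x‖ ≤ ∑ x, ∏ j, (‖y j‖ * u j x ^ ((p j)⁻¹).toReal) := by
        refine norm_sum_le_of_le _ fun x _ => ?_
        rw [norm_prod]
        exact prod_le_prod (fun _ _ => norm_nonneg _) fun j _ => hu j x
    _ = (∏ j, ‖y j‖) * ∑ x, ∏ j, u j x ^ ((p j)⁻¹).toReal := by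
        simp only [prod_mul_distrib, mul_sum]
    _ ≤ (∏ j, ‖y j‖) * (N : ℝ) ^ (1 - invSum p) := by
        refine mul_le_mul_of_nonneg_left ?_ (prod_nonneg fun _ _ => norm_nonneg _)
        exact sum_prod_rpow_le_rpow hN (fun j => ENNReal.toReal_nonneg) hp hu0 hu1
    _ = _ := mul_comm _ _

variable {κ : Type} [Fintype κ] [DecidableEq κ]

theorem rpow_le_blockSum_diagForm [Nonempty κ] (hm : 1 ≤ m) (b : Fin m → κ) {σ : ℝ} (hσ : 0 < σ) :
    (N : ℝ) ^ (1 / σ) ≤ blockSum b (diagForm 𝕜 N p) σ := by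
  have hm' : Nonempty (Fin m) := ⟨⟨0, hm⟩⟩
  refine Real.rpow_le_rpow (by positivity) ?_ (by positivity)
  have h1 : ∀ x : Fin N, diagForm 𝕜 N p (fun j => canonVec 𝕜 (p j) x) = 1 := by
    intro x
    rw [diagForm_apply, sum_eq_single x]
    · simp [canonVec]
    · intro x' _ hx'
      simp [canonVec, hx']
      omega
    · simp
  have hinj : Function.Injective fun (x : Fin N) (_ : κ) => x :=
    Function.const_injective
  calc (N : ℝ) = ∑ i ∈ univ.map ⟨_, hinj⟩,
        ‖diagForm 𝕜 N p (fun j => canonVec 𝕜 (p j) (i (b j)))‖ ^ σ := by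
        simp [h1]
    _ ≤ _ := sum_le_sum_of_subset_of_nonneg (subset_univ _) fun i _ _ => by positivity

/-- Testing on the diagonal form. The case N = 1 bounds the constant from below, and N → ∞ the
exponent. -/
theorem BlockIneq.natCast_rpow_le [Nonempty κ] (hm : 1 ≤ m) (hp : invSum p < 1) {b : Fin m → κ}
    {σ C : ℝ} (hσ : 0 < σ) (h : BlockIneq 𝕜 p b σ C) (hN : 0 < N) :
    (N : ℝ) ^ (1 / σ) ≤ C * (N : ℝ) ^ (1 - invSum p) := by
  have hN' : (0 : ℝ) < N := by exact_mod_cast hN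
  have h1 := (rpow_le_blockSum_diagForm hm b hσ).trans (h N hN (diagForm 𝕜 N p))
  have hC : 0 < C := pos_of_mul_pos_left ((Real.rpow_pos_of_pos hN' _).trans_le h1) (norm_nonneg _)
  exact h1.trans (mul_le_mul_of_nonneg_left (norm_diagForm_le hN hp) hC.le)

theorem BlockIneq.one_le [Nonempty κ] (hm : 1 ≤ m) (hp : invSum p < 1) {b : Fin m → κ}
    {σ C : ℝ} (hσ : 0 < σ) (h : BlockIneq 𝕜 p b σ C) : 1 ≤ C := by
  simpa using h.natCast_rpow_le hm hp hσ one_pos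

theorem BlockIneq.le_exponent [Nonempty κ] (hm : 1 ≤ m) (hp : invSum p < 1) {b : Fin m → κ}
    {σ C : ℝ} (hσ : 0 < σ) (h : BlockIneq 𝕜 p b σ C) : 1 / (1 - invSum p) ≤ σ := by
  by_contra! hlt
  rw [lt_div_iff₀ (by linarith), mul_comm, ← lt_div_iff₀ hσ] at hlt
  have ht := (tendsto_rpow_atTop (sub_pos.2 hlt)).comp (tendsto_natCast_atTop_atTop (R := ℝ))
  obtain ⟨N, hN, hN0⟩ :=
    ((ht.eventually_gt_atTop C).and (Filter.eventually_gt_atTop 0)).exists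
  have hN' : (0 : ℝ) < N := by exact_mod_cast hN0
  have h1 := h.natCast_rpow_le hm hp hσ hN0
  simp only [Function.comp_apply] at hN
  rw [Real.rpow_sub hN', lt_div_iff₀ (by positivity)] at hN
  linarith

/-! ### Optimal constants and the block inequalities -/

theorem BlockIneq.mono {b : Fin m → κ} {σ C C' : ℝ} (h : BlockIneq 𝕜 p b σ C) (hC : C ≤ C') :
    BlockIneq 𝕜 p b σ C' :=
  fun N hN T => (h N hN T).trans (mul_le_mul_of_nonneg_right hC (norm_nonneg _))

/-- The admissible constants form a nonempty closed set bounded below by 1, so the infimum is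
attained. -/
theorem BlockIneq.exists_isOptimalConst [Nonempty κ] (hm : 1 ≤ m) (hp : invSum p < 1)
    {b : Fin m → κ} {σ C : ℝ} (hσ : 0 < σ) (h : BlockIneq 𝕜 p b σ C) :
    ∃ C', 1 ≤ C' ∧ C' ≤ C ∧ IsOptimalConst 𝕜 p b σ C' := by
  have hbdd : BddBelow {C' : ℝ | BlockIneq 𝕜 p b σ C'} := ⟨1, fun _ h' => h'.one_le hm hp hσ⟩
  have hclosed : IsClosed {C' : ℝ | BlockIneq 𝕜 p b σ C'} := by
    simp only [BlockIneq, Set.ofPred_forall]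
    exact isClosed_iInter fun N => isClosed_iInter fun _ => isClosed_iInter fun T =>
      isClosed_le continuous_const (by fun_prop)
  have hmem := hclosed.csInf_mem ⟨C, h⟩ hbdd
  exact ⟨_, hmem.one_le hm hp hσ, csInf_le hbdd h, hmem, fun _ h' => csInf_le hbdd h'⟩

/-- As `b` is surjective, distinct block indices give distinct full indices, so one sum is part of
the other. -/
theorem blockSum_le_blockSum_id {b : Fin m → κ} (hb : Function.Surjective b)
    (T : ContinuousMultilinearMap 𝕜 (fun j : Fin m => PiLp (p j) (fun _ : Fin N => 𝕜)) 𝕜)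
    {σ : ℝ} (hσ : 0 < σ) : blockSum b T σ ≤ blockSum (id : Fin m → Fin m) T σ := by
  refine Real.rpow_le_rpow (sum_nonneg fun _ _ => by positivity) ?_ (by positivity)
  have hinj : Function.Injective fun (i : κ → Fin N) (j : Fin m) => i (b j) :=
    hb.injective_comp_right
  calc _ = ∑ i ∈ univ.map ⟨_, hinj⟩, ‖T (fun j => canonVec 𝕜 (p j) (i j))‖ ^ σ := by simp
    _ ≤ _ := sum_le_sum_of_subset_of_nonneg (subset_univ _) fun i _ _ => by positivity

/-- Merging arguments adds their exponents, so the restricted k-linear form has the same exponent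
sum and the k-linear inequality applies. -/
theorem blockIneq_of_lt_half {k : ℕ} (hk : 0 < k) (hp : invSum p ≤ 1 / 2) {b : Fin m → Fin k}
    (hb : Function.Surjective b) :
    BlockIneq 𝕜 p b (2 * (k : ℝ) / ((k : ℝ) + 1 - 2 * invSum p)) ((16 / 9) ^ (k - 1)) := by
  intro N _ T
  obtain ⟨σ, hσ⟩ := hb.hasRightInverse
  have hα : ∀ j, 0 ≤ ((p j)⁻¹).toReal := fun j => ENNReal.toReal_nonneg
  have h := (formBound_coeff T).comp_block hα hσ
  have hsum : ∑ r, ∑ j with b j = r, ((p j)⁻¹).toReal = invSum p := sum_fiberwise univ b _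
  have := h.rpow_sum_le_of_le_half hk (fun r => sum_nonneg fun j _ => hα j) (by rwa [hsum])
    (norm_nonneg _)
  rwa [hsum] at this

theorem blockIneq_id_of_half_le (hm : 1 ≤ m) (hp : 1 / 2 ≤ invSum p) (hp1 : invSum p < 1) :
    BlockIneq 𝕜 p (id : Fin m → Fin m) (1 / (1 - invSum p)) ((16 / 9) ^ (m - 1)) :=
  fun _ _ T => (formBound_coeff T).rpow_sum_le_of_half_le hm
    (fun _ => ENNReal.toReal_nonneg) hp hp1 (norm_nonneg _)

end Lp

theorem Composition.index_surjective {m : ℕ} (c : Composition m) : Function.Surjective c.index :=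
  fun r => ⟨c.embedding r ⟨0, c.one_le_blocksFun r⟩, c.index_embedding r _⟩

end HardyLittlewood

theorem mainTheorem7 (𝕜 : Type*) [RCLike 𝕜] (m : ℕ) (hm : 1 ≤ m) (p : Fin m → ℝ≥0∞)
    [∀ j, Fact (1 ≤ p j)] (hp : invSum p < 1) :
    (1 / 2 ≤ invSum p →
      ∃ D : ℝ, 1 ≤ D ∧
        IsOptimalConst 𝕜 p (id : Fin m → Fin m) (1 / (1 - invSum p)) D ∧
        ∀ c : Composition m,
          BlockIneq 𝕜 p c.index (1 / (1 - invSum p)) D ∧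
          IsOptimalExponent 𝕜 p c.index (1 / (1 - invSum p))) ∧
    (invSum p < 1 / 2 →
      ∃ C : ℝ, 1 ≤ C ∧
        ∀ c : Composition m,
          BlockIneq 𝕜 p c.index
            (2 * (c.length : ℝ) / ((c.length : ℝ) + 1 - 2 * invSum p)) C ∧
          ∃ C' : ℝ, 1 ≤ C' ∧ C' ≤ C ∧
            IsOptimalConst 𝕜 p c.index
              (2 * (c.length : ℝ) / ((c.length : ℝ) + 1 - 2 * invSum p)) C') := by
  have hlen : ∀ c : Composition m, 0 < c.length := fun c => c.length_pos_of_pos hm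
  have hρ : 0 < 1 / (1 - invSum p) := div_pos one_pos (by linarith)
  constructor
  · intro hp2
    have : Nonempty (Fin m) := ⟨⟨0, hm⟩⟩
    obtain ⟨D, hD1, -, hD⟩ :=
      (blockIneq_id_of_half_le (𝕜 := 𝕜) hm hp2 hp).exists_isOptimalConst hm hp hρ
    refine ⟨D, hD1, hD, fun c => ?_⟩
    have : Nonempty (Fin c.length) := ⟨⟨0, hlen c⟩⟩
    have hc : BlockIneq 𝕜 p c.index (1 / (1 - invSum p)) D := fun N hN T =>
      (blockSum_le_blockSum_id c.index_surjective T hρ).trans (hD.1 N hN T)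
    exact ⟨hc, ⟨hρ, D, hc⟩, fun σ ⟨hσ, _, hC⟩ => hC.le_exponent hm hp hσ⟩
  · intro hp2
    -- The constant (16/9) ^ (k - 1) depends on k; since k ≤ m, this power dominates all of them.
    refine ⟨(16 / 9) ^ m, one_le_pow₀ (by norm_num), fun c => ?_⟩
    have : Nonempty (Fin c.length) := ⟨⟨0, hlen c⟩⟩
    have hl : (0 : ℝ) < c.length := by exact_mod_cast hlen c
    have h : BlockIneq 𝕜 p c.index
        (2 * (c.length : ℝ) / ((c.length : ℝ) + 1 - 2 * invSum p)) ((16 / 9) ^ m) :=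
      (blockIneq_of_lt_half (hlen c) hp2.le c.index_surjective).mono
        (pow_le_pow_right₀ (by norm_num) ((Nat.sub_le _ _).trans c.length_le))
    exact ⟨h, h.exists_isOptimalConst hm hp (div_pos (by linarith) (by linarith))⟩
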